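/- Propositional formulas are built from countably many variables with $\neg,\wedge,\vee,\to$. Let $\varphi_1=\neg p_1\vee\neg\neg p_1$ and, for $k>1$, $$\varphi_k=\bigvee_{1\le i,j\le k,\ i\ne j}(\neg p_i\to\neg p_j)\ \vee\ \neg(\neg p_1\wedge\dots\wedge\neg p_k).$$ Let $\mathsf{IPC}+\varphi_k$ be the closure under modus ponens of intuitionistic propositional logic together with all substitution instances of $\varphi_k$. A Brouwer algebra is a bounded distributive lattice $L$ (join $+$, meet $\times$, least element $0$, greatest element $1$) with a binary operation $\to$ such that $b\le a+c\iff a\to b\le c$ for all $a,b,c\in L$; put $\neg a=a\to 1$. $L$ satisfies a formula $\sigma$ if $\sigma$ takes the value $0$ under every assignment of elements of $L$ to the variables, where $\vee,\wedge,\to,\neg$ are interpreted by $\times,+,\to,\neg$. For $n\ge 1$ let $\mathfrak B_n^{\bot}$ be the class of Brouwer algebras in which $0$ is meet-irreducible and $1$ is the join of an antichain of exactly $n$ join-irreducible elements (irreducibles are understood to be proper: a join-irreducible element is not $0$, a meet-irreducible element is not $1$). Let $k\ge 1$ and let $n$ be the least positive integer with $\binom{n}{\lfloor n/2\rfloor}\ge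 k$. Then $\mathsf{IPC}+\varphi_k$ is complete with respect to the class of finite algebras in $\mathfrak B_n^{\bot}$: for every formula $\sigma$, $\mathsf{IPC}+\varphi_k$ derives $\sigma$ if and only if every finite algebra in $\mathfrak B_n^{\bot}$ satisfies $\sigma$. -/

import Mathlib

universe u

/-- Formulas of propositional logic, with countably many propositional variables and the
primitive connectives negation, conjunction, disjunction and implication. -/
inductive PropFormula : Type
  | var : ℕ → PropFormula
  | neg : PropFormula → PropFormula
  | and : PropFormula → PropFormula → PropFormula
  | or : PropFormula → PropFormula → PropFormula
  | imp : PropFormula → PropFormula → PropFormula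

namespace PropFormula

/-- Simultaneous substitution of formulas for the propositional variables. -/
def subst (s : ℕ → PropFormula) : PropFormula → PropFormula
  | var i => s i
  | neg A => neg (subst s A)
  | and A B => and (subst s A) (subst s B)
  | or A B => or (subst s A) (subst s B)
  | imp A B => imp (subst s A) (subst s B)

/-- `Derivable Ax A`: the formula `A` is derivable in the logic `IPC + Ax`, where `IPC` is given by
the usual Hilbert calculus for intuitionistic propositional logic (with modus ponens as its
rule) and the members of `Ax` are used as additional axiom schemata, that is, every
substitution instance of a member of `Ax` is an axiom. -/
inductive Derivable (Ax : Set PropFormula) : PropFormula → Prop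
  | impK (A B : PropFormula) : Derivable Ax (imp A (imp B A))
  | impS (A B C : PropFormula) :
      Derivable Ax (imp (imp A (imp B C)) (imp (imp A B) (imp A C)))
  | andIntro (A B : PropFormula) : Derivable Ax (imp A (imp B (and A B)))
  | andLeft (A B : PropFormula) : Derivable Ax (imp (and A B) A)
  | andRight (A B : PropFormula) : Derivable Ax (imp (and A B) B)
  | orLeft (A B : PropFormula) : Derivable Ax (imp A (or A B))
  | orRight (A B : PropFormula) : Derivable Ax (imp B (or A B))
  | orElim (A B C : PropFormula) :
      Derivable Ax (imp (imp A C) (imp (imp B C) (imp (or A B) C)))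
  | negIntro (A B : PropFormula) :
      Derivable Ax (imp (imp A B) (imp (imp A (neg B)) (neg A)))
  | negElim (A B : PropFormula) : Derivable Ax (imp (neg A) (imp A B))
  | inst (A : PropFormula) (s : ℕ → PropFormula) : A ∈ Ax → Derivable Ax (subst s A)
  | mp (A B : PropFormula) : Derivable Ax (imp A B) → Derivable Ax A → Derivable Ax B

/-- The logic `IPC + A`, as a set of formulas. -/
def ipcPlus (A : PropFormula) : Set PropFormula := {B | Derivable {A} B}

/-- `negConj m` is the conjunction of the `m + 1` formulas `¬ p_0, …, ¬ p_m`. -/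
def negConj : ℕ → PropFormula
  | 0 => neg (var 0)
  | m + 1 => and (negConj m) (neg (var (m + 1)))

/-- The formula `φ_k`, for `k ≥ 1`, in the variables `p_0, …, p_{k-1}`: `φ_1` is `¬ p_0 ∨ ¬ ¬ p_0`,
and for `k > 1` it is the disjunction of all `¬ p_i → ¬ p_j` with `i ≠ j` and `i, j < k`, and of
`¬ (¬ p_0 ∧ … ∧ ¬ p_{k-1})`. (The value at `k = 0` has no meaning.) -/
def phi (k : ℕ) : PropFormula :=
  if k = 1 then or (neg (var 0)) (neg (neg (var 0)))
  else
    (((List.range k ×ˢ List.range k).filter (fun q => q.1 ≠ q.2)).map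
      (fun q => imp (neg (var q.1)) (neg (var q.2)))).foldr or (neg (negConj (k - 1)))

/-- The value of a formula in a Brouwer algebra. Brouwer algebras are Mathlib's co-Heyting
algebras: the arrow `a → b`, the least `c` with `b ≤ a ⊔ c`, is `b \ a` there, and `¬ a`, which is
`a → 1`, is `￢a`. Conjunction is the join and disjunction is the meet. -/
def eval {L : Type u} [CoheytingAlgebra L] (v : ℕ → L) : PropFormula → L
  | var i => v i
  | neg A => ￢(eval v A)
  | and A B => eval v A ⊔ eval v B
  | or A B => eval v A ⊓ eval v B
  | imp A B => eval v B \ eval v A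

end PropFormula

/-- A Brouwer algebra satisfies a formula if every substitution of its elements for the
variables yields the least element. -/
def BrouwerSatisfies (L : Type u) [CoheytingAlgebra L] (A : PropFormula) : Prop :=
  ∀ v : ℕ → L, PropFormula.eval v A = ⊥

/-- A logic `T` is complete with respect to a class `C` of Brouwer algebras if a formula is
derivable in `T` if and only if every algebra in `C` satisfies it. -/
def CompleteForBrouwerClass (T : Set PropFormula)
    (C : ∀ (L : Type u) [CoheytingAlgebra L], Prop) : Prop :=
  ∀ A : PropFormula, A ∈ T ↔ ∀ (L : Type u) [CoheytingAlgebra L], C L → BrouwerSatisfies L A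

/-- The class of Brouwer algebras whose top element is the join of an antichain of `n`
join-irreducible elements. -/
def InClassB (n : ℕ) (L : Type u) [CoheytingAlgebra L] : Prop :=
  ∃ X : Finset L, X.card = n ∧ IsAntichain (· ≤ ·) (X : Set L) ∧ (∀ x ∈ X, SupIrred x) ∧
    X.sup id = ⊤

/-- The subclass of algebras in which `0` is meet-irreducible. -/
def InClassBBot (n : ℕ) (L : Type u) [CoheytingAlgebra L] : Prop :=
  InClassB n L ∧ InfIrred (⊥ : L)

/-! Both directions turn on Sperner's theorem. Soundness: if `X` is the antichain of
join-irreducibles with join `⊤`, then `￢a` depends only on the set of `x ∈ X` not below `a`, and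
monotonically so. If no disjunct of `φ_k` vanished, the `k` variables would give `k` pairwise
incomparable subsets of `X`, all missing a common point. Sperner's bound on the `n - 1` remaining
points contradicts the minimality of `n` (`eval_phi_eq_bot`). Completeness: a nonderivable formula
is omitted by some prime theory `T₀`. Were there `n + 1` maximal consistent theories above `T₀`, the
middle layer of subsets of `n` of them would supply `k` incomparable sets avoiding the remaining
theory, and so an instance of `φ_k` outside `T₀` (`not_injective_of_isMaxOmitting`). The canonical
model above `T₀` is then filtered to a finite rooted poset with exactly `n` maximal points, whose
upper sets form the refuting algebra (`exists_not_brouwerSatisfies`). -/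

namespace PropFormula

/-! ### Soundness: evaluation in algebras of the class. -/

section Soundness

variable {L : Type u} [CoheytingAlgebra L]

theorem eval_foldr_or_eq_bot (v : ℕ → L) (b : PropFormula) (l : List PropFormula)
    (h : eval v b = ⊥ ∨ ∃ x ∈ l, eval v x = ⊥) : eval v (l.foldr or b) = ⊥ := by
  induction l with
  | nil => simpa using h
  | cons a l ih =>
    simp only [List.foldr_cons, eval]
    by_cases ha : eval v a = ⊥
    · simp [ha]
    · rw [ih, inf_bot_eq]
      rcases h with h | ⟨x, hx, hx'⟩
      · exact Or.inl h
      · rcases List.mem_cons.1 hx with rfl | hx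
        · exact absurd hx' ha
        · exact Or.inr ⟨x, hx, hx'⟩

theorem hnot_le_eval_negConj (v : ℕ → L) {i m : ℕ} (h : i ≤ m) :
    ￢(v i) ≤ eval v (negConj m) := by
  induction m with
  | zero =>
    obtain rfl : i = 0 := by omega
    exact le_rfl
  | succ m ih =>
    rcases Nat.of_le_succ h with h | rfl
    · exact (ih h).trans le_sup_left
    · exact le_sup_right

/-- The join-irreducible elements of a decomposition of the top element that are not below `a`
are those below `￢a`. -/
theorem le_hnot_iff_of_sup_eq_top {X : Finset L} (hX : IsAntichain (· ≤ ·) (X : Set L))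
    (hirr : ∀ x ∈ X, SupIrred x) (htop : X.sup id = ⊤) {a x : L} (hx : x ∈ X) :
    x ≤ ￢a ↔ ¬ x ≤ a := by
  classical
  have hp : ∀ x ∈ X, SupPrime x := fun x hx => supPrime_iff_supIrred.2 (hirr x hx)
  constructor
  · intro h hxa
    -- The irreducibles not below `a` join with `a` to `⊤`; primeness then puts `x` under one of
    -- them, and the antichain condition makes the two equal.
    have hle : ￢a ≤ (X.filter (fun y => ¬ y ≤ a)).sup id := by
      rw [hnot_le_iff_codisjoint_right, codisjoint_iff_le_sup, ← htop]
      refine Finset.sup_le fun y hy => ?_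
      by_cases hya : y ≤ a
      · exact hya.trans le_sup_left
      · exact le_sup_of_le_right
          (Finset.le_sup (f := id) (Finset.mem_filter.2 ⟨hy, hya⟩))
    obtain ⟨y, hy, hxy⟩ := (hp x hx).le_finset_sup.1 (h.trans hle)
    obtain ⟨hyX, hya⟩ := Finset.mem_filter.1 hy
    exact hya (hX.eq hx hyX hxy ▸ hxa)
  · intro h
    have : x ≤ a ⊔ ￢a := by simp
    exact ((hp x hx).le_sup.1 this).resolve_left h

theorem eval_phi_eq_bot {k n : ℕ} (hk : 1 ≤ k)
    (hn : IsLeast {m : ℕ | 1 ≤ m ∧ k ≤ m.choose (m / 2)} n)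
    (hL : InClassB n L) (v : ℕ → L) : eval v (phi k) = ⊥ := by
  classical
  obtain ⟨X, hcard, hX, hirr, htop⟩ := hL
  have hkey : ∀ {a x : L}, x ∈ X → (x ≤ ￢a ↔ ¬ x ≤ a) := fun hx =>
    le_hnot_iff_of_sup_eq_top hX hirr htop hx
  have hle : ∀ a b : L, (∀ x ∈ X, ¬ x ≤ a → ¬ x ≤ b) → ￢a ≤ ￢b := by
    intro a b h
    rw [hnot_le_iff_codisjoint_right, codisjoint_iff_le_sup, ← htop]
    refine Finset.sup_le fun x hx => ?_
    by_cases hxa : x ≤ a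
    · exact hxa.trans le_sup_left
    · exact le_sup_of_le_right ((hkey hx).2 (h x hx hxa))
  unfold phi
  split_ifs with h1
  · subst h1
    have hn1 : n = 1 := le_antisymm (hn.2 ⟨le_rfl, by simp⟩) hn.1.1
    obtain ⟨x, rfl⟩ := Finset.card_eq_one.1 (hcard.trans hn1)
    have hx : x = ⊤ := by simpa using htop
    subst hx
    have h := hkey (a := v 0) (Finset.mem_singleton_self _)
    simp only [eval]
    by_cases hv : (⊤ : L) ≤ v 0
    · rw [top_le_iff.1 hv]; simp
    · rw [top_le_iff.1 (h.2 hv)]; simp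
  · apply eval_foldr_or_eq_bot
    -- Two comparable sets kill one of the implications; otherwise the last disjunct must vanish.
    by_cases hcmp : ∃ i < k, ∃ j < k, i ≠ j ∧ ∀ x ∈ X, ¬ x ≤ v j → ¬ x ≤ v i
    · obtain ⟨i, hi, j, hj, hij, h⟩ := hcmp
      refine Or.inr ⟨imp (neg (var i)) (neg (var j)), ?_, ?_⟩
      · refine List.mem_map.2 ⟨(i, j), ?_, rfl⟩
        simp [hi, hj, hij]
      · simpa [eval] using hle _ _ h
    · left
      push Not at hcmp
      simp only [eval]
      suffices hT : (⊤ : L) ≤ eval v (negConj (k - 1)) by rw [top_le_iff.1 hT]; simp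
      rw [← htop]
      refine Finset.sup_le fun x hx => ?_
      by_contra hxn
      have hxv : ∀ i < k, x ≤ v i := fun i hi => by
        by_contra h
        exact hxn (((hkey hx).2 h).trans (hnot_le_eval_negConj v (by omega)))
      -- the sets of irreducibles not below `v i` form an antichain avoiding `x`
      let Y := X.erase x
      let S : Fin k → Finset Y := fun i => Finset.univ.filter (fun y => ¬ (y : L) ≤ v i)
      have hS : ∀ i j : Fin k, S j ⊆ S i → i = j := by
        intro i j h
        by_contra hij
        obtain ⟨y, hy, hyj, hyi⟩ :=
          hcmp i i.2 j j.2 (fun e => hij (Fin.ext e))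
        have hyx : y ≠ x := fun e => hyj (e ▸ hxv j j.2)
        have := @h ⟨y, Finset.mem_erase.2 ⟨hyx, hy⟩⟩ (by simpa [S] using hyj)
        simp only [S, Finset.mem_filter] at this
        exact this.2 hyi
      have hanti : IsAntichain (· ⊆ ·) ((Finset.univ.image S : Finset (Finset Y)) : Set (Finset Y)) := by
        intro A hA B hB hAB hsub
        simp only [Finset.coe_image, Finset.coe_univ, Set.image_univ, Set.mem_range] at hA hB
        obtain ⟨j, rfl⟩ := hA
        obtain ⟨i, rfl⟩ := hB
        exact hAB (by rw [hS i j hsub])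
      have hsp := hanti.sperner
      rw [Finset.card_image_of_injective _ (fun i j h => hS i j h.ge), Finset.card_univ,
        Fintype.card_fin, Fintype.card_coe, Finset.card_erase_of_mem hx, hcard] at hsp
      -- Minimality says nothing about `n - 1 = 0`; there the bound itself reads `k ≤ 1`, against `k
      -- ≠ 1`.
      by_cases hn1 : n = 1
      · subst hn1
        simp at hsp
        omega
      · have h1n := hn.1.1
        have := hn.2 (show n - 1 ∈ _ from ⟨by omega, hsp⟩)
        omega

theorem eval_subst (v : ℕ → L) (s : ℕ → PropFormula) (A : PropFormula) :
    eval v (subst s A) = eval (fun i => eval v (s i)) A := by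
  induction A <;> simp_all [eval, subst]

theorem eval_eq_bot_of_derivable {Ax : Set PropFormula}
    (hAx : ∀ A ∈ Ax, ∀ v : ℕ → L, eval v A = ⊥) {A : PropFormula} (h : Derivable Ax A)
    (v : ℕ → L) : eval v A = ⊥ := by
  induction h with
  | impK A B => simp [eval]
  | impS A B C =>
    simp only [eval, sdiff_eq_bot_iff, sdiff_le_iff]
    generalize eval v A = a, eval v B = b, eval v C = c
    have h1 : b ≤ a ⊔ b \ a := le_sup_sdiff
    have h2 : c ≤ b ⊔ c \ b := le_sup_sdiff
    have h3 : c \ b ≤ a ⊔ (c \ b) \ a := le_sup_sdiff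
    calc c ≤ b ⊔ c \ b := h2
      _ ≤ (a ⊔ b \ a) ⊔ (a ⊔ (c \ b) \ a) := sup_le_sup h1 h3
      _ ≤ _ := by
        simp only [sup_le_iff]
        refine ⟨⟨?_, ?_⟩, ?_, ?_⟩
        · exact le_sup_left
        · exact le_sup_of_le_right le_sup_left
        · exact le_sup_left
        · exact le_sup_of_le_right le_sup_right
  | andIntro A B =>
    simp only [eval, sdiff_eq_bot_iff, sdiff_le_iff]
    exact (sup_comm _ _).le
  | andLeft A B => simp [eval]
  | andRight A B => simp [eval]
  | orLeft A B => simp [eval]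
  | orRight A B => simp [eval]
  | orElim A B C =>
    simp only [eval, sdiff_eq_bot_iff, sdiff_le_iff]
    generalize eval v A = a, eval v B = b, eval v C = c
    rw [sup_inf_right]
    refine le_inf ?_ ?_
    · have h : c ≤ a ⊔ c \ a := le_sup_sdiff
      exact h.trans (sup_le_sup_left le_sup_right _)
    · have h : c ≤ b ⊔ c \ b := le_sup_sdiff
      exact h.trans (sup_le_sup_left le_sup_left _)
  | negIntro A B =>
    simp only [eval, sdiff_eq_bot_iff, sdiff_le_iff]
    generalize eval v A = a, eval v B = b
    rw [hnot_le_iff_codisjoint_right, codisjoint_iff_le_sup]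
    have h1 : b ≤ a ⊔ b \ a := le_sup_sdiff
    have h3 : ￢b ≤ a ⊔ (￢b) \ a := le_sup_sdiff
    calc (⊤ : L) = b ⊔ ￢b := by simp
      _ ≤ (a ⊔ b \ a) ⊔ (a ⊔ (￢b) \ a) := sup_le_sup h1 h3
      _ ≤ _ := by
        simp only [sup_le_iff]
        refine ⟨⟨?_, ?_⟩, ?_, ?_⟩
        · exact le_sup_left
        · exact le_sup_of_le_right le_sup_right
        · exact le_sup_left
        · exact le_sup_of_le_right le_sup_left
  | negElim A B =>
    simp only [eval, sdiff_eq_bot_iff, sdiff_le_iff]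
    simp
  | inst A s hA => rw [eval_subst]; exact hAx A hA _
  | mp A B _ _ ih1 ih2 => simpa [eval, ih2] using ih1

end Soundness

/-! ### Prime and maximal theories, and the bound on maximal extensions. -/

section Theories

/-- A theory over `Ax`: a set of formulas containing `IPC + Ax` and closed under modus ponens. -/
structure IsTheory (Ax T : Set PropFormula) : Prop where
  derivable : ∀ {A}, Derivable Ax A → A ∈ T
  mp : ∀ {A B}, imp A B ∈ T → A ∈ T → B ∈ T

/-- A contradiction, used as a constant for falsity. -/
def falsum : PropFormula := and (var 0) (neg (var 0))

/-- A theory maximal among the theories omitting `A`. -/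
def IsMaxOmitting (Ax : Set PropFormula) (A : PropFormula) (T : Set PropFormula) : Prop :=
  Maximal (fun T => IsTheory Ax T ∧ A ∉ T) T

/-- A consistent theory with the disjunction property. -/
structure IsPrimeTheory (Ax T : Set PropFormula) : Prop extends IsTheory Ax T where
  falsum_notMem : falsum ∉ T
  prime : ∀ {A B}, or A B ∈ T → A ∈ T ∨ B ∈ T

variable {Ax T : Set PropFormula} {A B C : PropFormula}

namespace IsTheory

theorem weaken (h : IsTheory Ax T) (hB : B ∈ T) : imp A B ∈ T :=
  h.mp (h.derivable (.impK _ _)) hB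

theorem imp_mp (h : IsTheory Ax T) (h1 : imp A (imp B C) ∈ T) (h2 : imp A B ∈ T) : imp A C ∈ T :=
  h.mp (h.mp (h.derivable (.impS _ _ _)) h1) h2

theorem imp_self_mem (h : IsTheory Ax T) (A : PropFormula) : imp A A ∈ T :=
  h.imp_mp (h.derivable (.impK A (imp A A))) (h.derivable (.impK A A))

theorem and_mem_iff (h : IsTheory Ax T) : and A B ∈ T ↔ A ∈ T ∧ B ∈ T :=
  ⟨fun hAB => ⟨h.mp (h.derivable (.andLeft _ _)) hAB, h.mp (h.derivable (.andRight _ _)) hAB⟩,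
    fun hAB => h.mp (h.mp (h.derivable (.andIntro _ _)) hAB.1) hAB.2⟩

theorem mem_of_neg_mem (h : IsTheory Ax T) (hn : neg A ∈ T) (hA : A ∈ T) (B : PropFormula) :
    B ∈ T :=
  h.mp (h.mp (h.derivable (.negElim _ _)) hn) hA

theorem mem_of_falsum_mem (h : IsTheory Ax T) (hf : falsum ∈ T) (B : PropFormula) : B ∈ T :=
  have := h.and_mem_iff.1 hf
  h.mem_of_neg_mem this.2 this.1 B

/-- The theory generated by `T` and `A`. -/
theorem adjoin (h : IsTheory Ax T) (A : PropFormula) : IsTheory Ax {C | imp A C ∈ T} :=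
  ⟨fun hC => h.weaken (h.derivable hC), fun h1 h2 => h.imp_mp h1 h2⟩

theorem neg_mem_of_imp_falsum_mem (h : IsTheory Ax T) (hA : imp A falsum ∈ T) : neg A ∈ T :=
  have h' := (h.adjoin A).and_mem_iff.1 hA
  h.mp (h.mp (h.derivable (.negIntro _ _)) h'.1) h'.2

theorem exists_isMaxOmitting (h : IsTheory Ax T) (hA : A ∉ T) :
    ∃ M, T ⊆ M ∧ IsMaxOmitting Ax A M := by
  refine zorn_subset_nonempty {T | IsTheory Ax T ∧ A ∉ T} ?_ T ⟨h, hA⟩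
  rintro c hc hchain ⟨T₀, hT₀⟩
  refine ⟨⋃₀ c, ⟨⟨fun hB => ⟨T₀, hT₀, (hc hT₀).1.derivable hB⟩, ?_⟩, ?_⟩,
    fun s hs => Set.subset_sUnion_of_mem hs⟩
  · rintro B C ⟨T₁, hT₁, h₁⟩ ⟨T₂, hT₂, h₂⟩
    rcases hchain.total hT₁ hT₂ with hle | hle
    · exact ⟨T₂, hT₂, (hc hT₂).1.mp (hle h₁) h₂⟩
    · exact ⟨T₁, hT₁, (hc hT₁).1.mp h₁ (hle h₂)⟩
  · rintro ⟨T₁, hT₁, h₁⟩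
    exact (hc hT₁).2 h₁

end IsTheory

theorem isTheory_setOf_derivable (Ax : Set PropFormula) : IsTheory Ax {A | Derivable Ax A} :=
  ⟨fun h => h, fun h1 h2 => .mp _ _ h1 h2⟩

/-- Otherwise the theory generated by `T` and `B` would be a larger one omitting `A`. -/
theorem IsMaxOmitting.imp_mem (h : IsMaxOmitting Ax A T) (hB : B ∉ T) : imp B A ∈ T := by
  by_contra hBA
  have := h.2 (y := {C | imp B C ∈ T}) ⟨h.1.1.adjoin B, hBA⟩ (fun C hC => h.1.1.weaken hC)
  exact hB (this (h.1.1.imp_self_mem B))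

theorem IsMaxOmitting.isPrimeTheory (h : IsMaxOmitting Ax A T) : IsPrimeTheory Ax T where
  toIsTheory := h.1.1
  falsum_notMem hf := h.1.2 (h.1.1.mem_of_falsum_mem hf A)
  prime {B C} hBC := by
    by_contra! hn
    have hT := h.1.1
    exact h.1.2 (hT.mp (hT.mp (hT.mp (hT.derivable (.orElim _ _ _)) (h.imp_mem hn.1))
      (h.imp_mem hn.2)) hBC)

theorem IsMaxOmitting.neg_mem_iff (h : IsMaxOmitting Ax falsum T) : neg B ∈ T ↔ B ∉ T :=
  ⟨fun hn hB => h.1.2 (h.1.1.mem_of_neg_mem hn hB _),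
    fun hB => h.1.1.neg_mem_of_imp_falsum_mem (h.imp_mem hB)⟩

namespace IsPrimeTheory

theorem or_mem_iff (h : IsPrimeTheory Ax T) : or A B ∈ T ↔ A ∈ T ∨ B ∈ T :=
  ⟨h.prime, fun hAB => hAB.elim (h.mp (h.derivable (.orLeft _ _)))
    (h.mp (h.derivable (.orRight _ _)))⟩

theorem exists_of_imp_notMem (h : IsPrimeTheory Ax T) (hAB : imp A B ∉ T) :
    ∃ T', IsPrimeTheory Ax T' ∧ T ⊆ T' ∧ A ∈ T' ∧ B ∉ T' := by
  obtain ⟨M, hM, hmax⟩ := (h.adjoin A).exists_isMaxOmitting (A := B) hAB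
  exact ⟨M, hmax.isPrimeTheory, fun C hC => hM (h.weaken hC), hM (h.imp_self_mem A), hmax.1.2⟩

theorem exists_of_neg_notMem (h : IsPrimeTheory Ax T) (hA : neg A ∉ T) :
    ∃ T', IsPrimeTheory Ax T' ∧ T ⊆ T' ∧ A ∈ T' := by
  obtain ⟨T', h1, h2, h3, -⟩ := h.exists_of_imp_notMem (A := A) (B := falsum)
    (fun hf => hA (h.neg_mem_of_imp_falsum_mem hf))
  exact ⟨T', h1, h2, h3⟩

theorem mem_of_subst_foldr_or_mem (h : IsPrimeTheory Ax T) (s : ℕ → PropFormula)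
    (b : PropFormula) (l : List PropFormula) (hl : subst s (l.foldr or b) ∈ T) :
    subst s b ∈ T ∨ ∃ x ∈ l, subst s x ∈ T := by
  induction l with
  | nil => exact Or.inl hl
  | cons a l ih =>
    rcases h.prime hl with h' | h'
    · exact Or.inr ⟨a, by simp, h'⟩
    · rcases ih h' with h' | ⟨x, hx, h'⟩
      · exact Or.inl h'
      · exact Or.inr ⟨x, by simp [hx], h'⟩

end IsPrimeTheory

theorem IsTheory.subst_negConj_mem (h : IsTheory Ax T) (s : ℕ → PropFormula) (m : ℕ)
    (hm : ∀ i ≤ m, neg (s i) ∈ T) : subst s (negConj m) ∈ T := by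
  induction m with
  | zero => exact hm 0 le_rfl
  | succ m ih =>
    exact h.and_mem_iff.2 ⟨ih fun i hi => hm i (by omega), hm (m + 1) le_rfl⟩

/-- Finitely many distinct maximal consistent theories realise every pattern of membership. -/
theorem exists_mem_iff_of_injective {ι : Type*} [Fintype ι] {M : ι → Set PropFormula}
    (hM : ∀ i, IsMaxOmitting Ax falsum (M i)) (hinj : Function.Injective M) (S : Finset ι) :
    ∃ A, ∀ j, A ∈ M j ↔ j ∈ S := by
  classical
  have hsep : ∀ (i : ι) (J : Finset ι), i ∉ J → ∃ A ∈ M i, ∀ j ∈ J, A ∉ M j := by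
    intro i J
    induction J using Finset.induction_on with
    | empty => exact fun _ => ⟨_, (hM i).1.1.imp_self_mem falsum, by simp⟩
    | insert j J _ ih =>
      intro hi
      rw [Finset.mem_insert, not_or] at hi
      obtain ⟨A, hA, hAJ⟩ := ih hi.2
      obtain ⟨B, hB, hBj⟩ : ∃ B ∈ M i, B ∉ M j := by
        by_contra! hsub
        exact hi.1 (hinj (Set.Subset.antisymm hsub ((hM i).2 (hM j).1 hsub)))
      refine ⟨and A B, (hM i).1.1.and_mem_iff.2 ⟨hA, hB⟩, fun l hl hAB => ?_⟩
      have hAB := (hM l).1.1.and_mem_iff.1 hAB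
      rcases Finset.mem_insert.1 hl with rfl | hl
      · exact hBj hAB.2
      · exact hAJ l hl hAB.1
  induction S using Finset.induction_on with
  | empty => exact ⟨falsum, fun j => by simpa using (hM j).1.2⟩
  | insert i S _ ih =>
    obtain ⟨A, hA⟩ := ih
    -- `B` lies in `M i` alone, so the disjunction with `A` adds just `i` to the pattern.
    obtain ⟨B, hB, hBJ⟩ := hsep i (Finset.univ.erase i) (by simp)
    refine ⟨or B A, fun j => ?_⟩
    rw [(hM j).isPrimeTheory.or_mem_iff, hA, Finset.mem_insert]
    refine or_congr_left ⟨fun h => ?_, fun h => h ▸ hB⟩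
    by_contra hj
    exact hBJ j (by simp [hj]) h

/-- Above a prime theory containing `IPC + φ_k` there are at most `n` maximal theories. -/
theorem not_injective_of_isMaxOmitting {k n : ℕ} (hk : k ≤ n.choose (n / 2))
    (hT : IsPrimeTheory {phi k} T) {M : Fin (n + 1) → Set PropFormula}
    (hM : ∀ i, IsMaxOmitting {phi k} falsum (M i)) (hTM : ∀ i, T ⊆ M i) (hn : 1 ≤ n) :
    ¬ Function.Injective M := by
  intro hinj
  choose ψ hψ using exists_mem_iff_of_injective hM hinj
  have hphi : ∀ s, subst s (phi k) ∈ T := fun s => hT.derivable (.inst _ s rfl)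
  unfold phi at hphi
  split_ifs at hphi with h1
  -- The variable becomes a formula true at `M 0` only: `M 0` excludes its negation, the last theory
  -- its double negation.
  · rcases hT.prime (hphi fun _ => ψ {0}) with h | h
    · exact (hM 0).neg_mem_iff.1 (hTM 0 h) ((hψ _ _).2 (by simp))
    · have h := (hM (Fin.last n)).neg_mem_iff.1 (hTM _ h)
      refine h ((hM _).neg_mem_iff.2 fun h' => ?_)
      have := (hψ _ _).1 h'
      simp only [Finset.mem_singleton, Fin.ext_iff, Fin.val_last, Fin.val_zero] at this
      omega
  · obtain ⟨f⟩ : Nonempty (Fin k ↪ Finset.powersetCard (n / 2) (Finset.univ : Finset (Fin n))) :=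
      Function.Embedding.nonempty_of_card_le (by simpa using hk)
    -- The shift by `succ` keeps `0` out of every set, so `M 0` contains all the `¬ s i` and refutes
    -- the last disjunct.
    let S : Fin k → Finset (Fin (n + 1)) := fun i => (f i : Finset (Fin n)).map (Fin.succEmb n)
    have hS : ∀ i j, S i ⊆ S j → i = j := by
      intro i j h
      have hc : ∀ i, (f i : Finset (Fin n)).card = n / 2 :=
        fun i => (Finset.mem_powersetCard.1 (f i).2).2
      exact f.injective (Subtype.ext (Finset.eq_of_subset_of_card_le (Finset.map_subset_map.1 h)
        (by rw [hc, hc])))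
    let s : ℕ → PropFormula := fun i => if h : i < k then ψ (S ⟨i, h⟩) else falsum
    have hs : ∀ (i : ℕ) (h : i < k) (j), neg (s i) ∈ M j ↔ j ∉ S ⟨i, h⟩ := by
      intro i h j
      rw [(hM j).neg_mem_iff]
      simp only [s, dif_pos h, hψ]
    rcases hT.mem_of_subst_foldr_or_mem s _ _ (hphi s) with h | ⟨x, hx, h⟩
    · refine (hM 0).neg_mem_iff.1 (hTM 0 h) ((hM 0).1.1.subst_negConj_mem s _ fun i hi => ?_)
      rcases Nat.lt_or_ge i k with hik | hik
      · rw [hs i hik]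
        simp [S]
      -- Truncated subtraction: `i ≤ k - 1` and `k ≤ i` hold together only for `k = 0`.
      · obtain rfl : k = 0 := by omega
        rw [(hM 0).neg_mem_iff]
        simpa [s] using (hM 0).1.2
    · obtain ⟨⟨i, j⟩, hij, rfl⟩ := List.mem_map.1 hx
      simp only [List.mem_filter, List.mem_product, List.mem_range, ne_eq,
        decide_eq_true_eq] at hij
      obtain ⟨⟨hi, hj⟩, hne⟩ := hij
      refine hne (Fin.mk.inj_iff.1 (hS ⟨j, hj⟩ ⟨i, hi⟩ fun x hxj => ?_)).symm
      by_contra hxi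
      exact (hs j hj x).1 ((hM x).1.1.mp (hTM x h) ((hs i hi x).2 hxi)) hxj

end Theories

/-! ### Algebras of upper sets and Kripke forcing. -/

section Frames

/-- Since `UpperSet` carries reverse inclusion, join is intersection and the difference obeys the
Kripke clause for implication. -/
theorem mem_sdiff_upperSet_iff {P : Type u} [PartialOrder P] {a b : UpperSet P} {p : P} :
    p ∈ a \ b ↔ ∀ q, p ≤ q → q ∈ b → q ∈ a := by
  constructor
  · intro h q hpq hq
    have hle : a ≤ b ⊔ a \ b := le_sup_sdiff
    exact hle ⟨hq, (a \ b).upper hpq h⟩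
  · intro h
    have hle : a \ b ≤ UpperSet.Ici p :=
      sdiff_le_iff.2 fun q hq => h q hq.2 hq.1
    exact hle (le_refl p)

theorem mem_hnot_upperSet_iff {P : Type u} [PartialOrder P] {a : UpperSet P} {p : P} :
    p ∈ ￢a ↔ ∀ q, p ≤ q → q ∉ a := by
  rw [← top_sdiff', mem_sdiff_upperSet_iff]
  rfl

/-- The upper sets of a rooted poset in which every element is below one of exactly `n` maximal
elements. -/
theorem inClassBBot_upperSet {P : Type u} [PartialOrder P] {n : ℕ} (r : P) (hr : ∀ p, r ≤ p)
    (m : Fin n → P) (hinj : Function.Injective m) (hmax : ∀ i p, m i ≤ p → p = m i)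
    (hcof : ∀ p, ∃ i, p ≤ m i) : InClassBBot n (UpperSet P) := by
  classical
  let x : Fin n → UpperSet P := fun i => (LowerSet.Iic (m i)).compl
  have hx : ∀ i p, p ∈ x i ↔ ¬ p ≤ m i := fun i p => Iff.rfl
  have hanti : ∀ i j, x i ≤ x j → i = j := by
    intro i j h
    by_contra hij
    refine (hx i (m i)).1 (h ((hx j (m i)).2 fun hle => hij ?_)) le_rfl
    exact (hinj (hmax i _ hle)).symm
  refine ⟨⟨Finset.univ.image x, ?_, ?_, ?_, ?_⟩, ?_, ?_⟩
  · rw [Finset.card_image_of_injective _ fun i j h => hanti i j h.le]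
    simp
  · intro a ha b hb hab hle
    simp only [Finset.coe_image, Finset.coe_univ, Set.image_univ, Set.mem_range] at ha hb
    obtain ⟨i, rfl⟩ := ha
    obtain ⟨j, rfl⟩ := hb
    exact hab (by rw [hanti i j hle])
  · intro a ha
    obtain ⟨i, -, rfl⟩ := Finset.mem_image.1 ha
    refine ⟨fun hmin => ?_, fun b c hbc => ?_⟩
    · have h : m i ∈ x i := hmin (bot_le : ⊥ ≤ x i) trivial
      exact (hx i _).1 h le_rfl
    -- `x i` is the largest upper set missing `m i`, so two strictly larger ones both contain `m i`,
    -- as does their intersection.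
    · have key : ∀ d : UpperSet P, d ≤ x i → m i ∉ d → d = x i := fun d hd hmd =>
        hd.antisymm fun p hp => (hx i p).2 fun hpm => hmd (d.upper hpm hp)
      by_contra! hne
      have hb : m i ∈ b := by
        by_contra h
        exact hne.1 (key b (hbc ▸ le_sup_left) h)
      have hc : m i ∈ c := by
        by_contra h
        exact hne.2 (key c (hbc ▸ le_sup_right) h)
      have : m i ∈ x i := hbc ▸ (⟨hb, hc⟩ : m i ∈ b ⊔ c)
      exact (hx i _).1 this le_rfl
  · rw [eq_top_iff]
    intro p hp
    obtain ⟨i, hi⟩ := hcof p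
    have hle : x i ≤ (Finset.univ.image x).sup id :=
      Finset.le_sup (f := id) (Finset.mem_image_of_mem x (Finset.mem_univ i))
    exact ((hx i p).1 (hle hp) hi).elim
  · intro hmaxi
    have : r ∈ (⊤ : UpperSet P) := hmaxi (bot_le : ⊥ ≤ (⊤ : UpperSet P)) trivial
    exact this
  · intro b c hbc
    have key : ∀ d : UpperSet P, r ∈ d → d = ⊥ := fun d hd =>
      eq_bot_iff.2 fun p _ => d.upper (hr p) hd
    have : r ∈ b ⊓ c := hbc ▸ (trivial : r ∈ (⊥ : UpperSet P))
    exact this.imp (key b) (key c)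

/-- The set of subformulas of a formula. -/
def subformulas : PropFormula → Set PropFormula
  | var i => {var i}
  | neg A => insert (neg A) (subformulas A)
  | and A B => insert (and A B) (subformulas A ∪ subformulas B)
  | or A B => insert (or A B) (subformulas A ∪ subformulas B)
  | imp A B => insert (imp A B) (subformulas A ∪ subformulas B)

theorem finite_subformulas (A : PropFormula) : (subformulas A).Finite := by
  induction A <;> simp_all [subformulas]

theorem self_mem_subformulas (A : PropFormula) : A ∈ subformulas A := by
  cases A <;> simp [subformulas]

/-- The truth lemma for a poset of points labelled with sets of formulas that behave like prime
theories on the formulas of `F`. -/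
theorem mem_eval_iff {P : Type u} [PartialOrder P] (F : Set PropFormula)
    (f : P → Set PropFormula) (hmono : Monotone f)
    (hand : ∀ p A B, and A B ∈ F → (and A B ∈ f p ↔ A ∈ f p ∧ B ∈ f p))
    (hor : ∀ p A B, or A B ∈ F → (or A B ∈ f p ↔ A ∈ f p ∨ B ∈ f p))
    (himp : ∀ p A B, imp A B ∈ F →
      (imp A B ∈ f p ↔ ∀ q, p ≤ q → A ∈ f q → B ∈ f q))
    (hneg : ∀ p A, neg A ∈ F → (neg A ∈ f p ↔ ∀ q, p ≤ q → A ∉ f q))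
    (A : PropFormula) (hA : subformulas A ⊆ F) (p : P) :
    p ∈ eval (fun i => (⟨{p | var i ∈ f p}, fun _ _ h hp => hmono h hp⟩ : UpperSet P)) A ↔
      A ∈ f p := by
  induction A generalizing p with
  | var i => rfl
  | neg A ih =>
    have ih := ih ((Set.subset_insert _ _).trans hA)
    rw [hneg p A (hA (self_mem_subformulas _)), eval, mem_hnot_upperSet_iff]
    simp only [ih]
  | and A B ihA ihB =>
    have h := (Set.subset_insert _ _).trans hA
    rw [hand p A B (hA (self_mem_subformulas _)), eval, UpperSet.mem_sup_iff,
      ihA (Set.subset_union_left.trans h), ihB (Set.subset_union_right.trans h)]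
  | or A B ihA ihB =>
    have h := (Set.subset_insert _ _).trans hA
    rw [hor p A B (hA (self_mem_subformulas _)), eval, UpperSet.mem_inf_iff,
      ihA (Set.subset_union_left.trans h), ihB (Set.subset_union_right.trans h)]
  | imp A B ihA ihB =>
    have h := (Set.subset_insert _ _).trans hA
    rw [himp p A B (hA (self_mem_subformulas _)), eval, mem_sdiff_upperSet_iff]
    simp only [ihA (Set.subset_union_left.trans h), ihB (Set.subset_union_right.trans h)]

end Frames

/-! ### The finite countermodel. -/

section Completeness

variable {Ax : Set PropFormula}

/-- The points of the finite frame: traces on `F` of the prime theories above `T₀`, together with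
the maximal theories above them, and one separate point for every member of a
family `M` of maximal theories. -/
def framePoints (Ax T₀ F : Set PropFormula) {ι : Type u} (M : ι → Set PropFormula) :
    Set (Set PropFormula × (Set ι)ᵒᵈ) :=
  {q | ∃ T, IsPrimeTheory Ax T ∧ T₀ ⊆ T ∧ q.1 = T ∩ F ∧
    (q.2 = OrderDual.toDual {i | T ⊆ M i} ∨ ∃ i, T = M i ∧ q.2 = OrderDual.toDual {i})}

theorem finite_framePoints {T₀ F : Set PropFormula} (hF : F.Finite) {ι : Type u} [Finite ι]
    (M : ι → Set PropFormula) : (framePoints Ax T₀ F M).Finite := by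
  have : Finite (Set ι)ᵒᵈ := inferInstanceAs (Finite (Set ι))
  refine (hF.finite_subsets.prod (Set.finite_univ (α := (Set ι)ᵒᵈ))).subset ?_
  rintro q ⟨T, -, -, hq, -⟩
  exact ⟨hq ▸ Set.inter_subset_right, trivial⟩

/-- Successors in the finite frame: a prime theory extending the one of a point gives rise to a
point above it. -/
theorem exists_framePoint_ge {T₀ F : Set PropFormula} {ι : Type u} {M : ι → Set PropFormula}
    (hM : ∀ i, IsMaxOmitting Ax falsum (M i)) (p : framePoints Ax T₀ F M) :
    ∃ T, IsPrimeTheory Ax T ∧ p.1.1 = T ∩ F ∧ ∀ T', IsPrimeTheory Ax T' → T ⊆ T' →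
      ∃ q : framePoints Ax T₀ F M, p ≤ q ∧ q.1.1 = T' ∩ F := by
  obtain ⟨⟨p1, p2⟩, T, hT, h0, hp1, hp2⟩ := p
  refine ⟨T, hT, hp1, fun T' hT' hTT' => ?_⟩
  simp only at hp1 hp2
  rcases hp2 with hp2 | ⟨i, rfl, hp2⟩
  · refine ⟨⟨(T' ∩ F, OrderDual.toDual {i | T' ⊆ M i}), T', hT', h0.trans hTT', rfl, Or.inl rfl⟩,
      ⟨?_, ?_⟩, rfl⟩
    · exact hp1 ▸ Set.inter_subset_inter_left F hTT'
    · subst hp2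
      exact fun i (hi : T' ⊆ M i) => hTT'.trans hi
  -- A maximal theory has no proper consistent extension, so the point is its own successor.
  · obtain rfl : T' = M i :=
      ((hM i).2 ⟨hT'.toIsTheory, hT'.falsum_notMem⟩ hTT').antisymm hTT'
    exact ⟨_, le_rfl, hp1⟩

/-- Used to list the at most `n` maximal theories by exactly `n` indices, with repetitions if
necessary. -/
theorem exists_surjective_of_forall_not_injective {α : Type*} [Nonempty α] {n : ℕ}
    (h : ∀ g : Fin (n + 1) → α, ¬ Function.Injective g) :
    ∃ g : Fin n → α, Function.Surjective g := by
  have hfin : Finite α := by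
    by_contra hinf
    have : Infinite α := not_finite_iff_infinite.1 hinf
    exact h (fun i => Infinite.natEmbedding α i)
      ((Infinite.natEmbedding α).injective.comp Fin.val_injective)
  have := Fintype.ofFinite α
  have hcard : Fintype.card α ≤ n := by
    by_contra! hlt
    obtain ⟨f⟩ : Nonempty (Fin (n + 1) ↪ α) :=
      Function.Embedding.nonempty_of_card_le (by simpa using hlt)
    exact h f f.injective
  obtain ⟨f⟩ : Nonempty (α ↪ Fin n) :=
    Function.Embedding.nonempty_of_card_le (by simpa using hcard)
  exact ⟨Function.invFun f, Function.invFun_surjective f.injective⟩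

/-- A formula omitted by a prime theory with at most `n` maximal extensions is refuted in a finite
algebra whose top element is the join of exactly `n` join-irreducible elements. -/
theorem exists_not_brouwerSatisfies {T₀ : Set PropFormula} (hT₀ : IsPrimeTheory Ax T₀)
    {n : ℕ} (hcount : ∀ M : Fin (n + 1) → Set PropFormula,
      (∀ i, IsMaxOmitting Ax falsum (M i)) → (∀ i, T₀ ⊆ M i) → ¬ Function.Injective M)
    {A : PropFormula} (hA : A ∉ T₀) :
    ∃ (L : Type u) (_ : CoheytingAlgebra L), (Finite L ∧ InClassBBot n L) ∧
      ¬ BrouwerSatisfies L A := by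
  obtain ⟨M₀, hM₀, hM₀'⟩ := hT₀.exists_isMaxOmitting hT₀.falsum_notMem
  have : Nonempty {M // IsMaxOmitting Ax falsum M ∧ T₀ ⊆ M} := ⟨⟨M₀, hM₀', hM₀⟩⟩
  obtain ⟨g, hg⟩ := exists_surjective_of_forall_not_injective (n := n)
    (α := {M // IsMaxOmitting Ax falsum M ∧ T₀ ⊆ M}) fun g hinj =>
      hcount (fun i => (g i).1) (fun i => (g i).2.1) (fun i => (g i).2.2)
        (Subtype.val_injective.comp hinj)
  -- Theories may repeat or share a trace on `F`; the singleton labels still keep the `n` top points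
  -- distinct.
  let M : ULift.{u} (Fin n) → Set PropFormula := fun i => (g i.down).1
  have hM : ∀ i, IsMaxOmitting Ax falsum (M i) := fun i => (g i.down).2.1
  have hTM : ∀ i, T₀ ⊆ M i := fun i => (g i.down).2.2
  have hMsurj : ∀ T, IsTheory Ax T → falsum ∉ T → T₀ ⊆ T → ∃ i, T ⊆ M i := by
    intro T hT hf h0
    obtain ⟨N, hN, hN'⟩ := hT.exists_isMaxOmitting hf
    obtain ⟨i, hi⟩ := hg ⟨N, hN', h0.trans hN⟩
    exact ⟨⟨i⟩, by simpa [M, hi] using hN⟩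
  let F := subformulas A
  let P := framePoints Ax T₀ F M
  have : Finite P := (finite_framePoints (finite_subformulas A) M).to_subtype
  have : Finite (UpperSet P) := Finite.of_injective (fun s : UpperSet P => (s : Set P))
    SetLike.coe_injective
  let r : P := ⟨(T₀ ∩ F, OrderDual.toDual {i | T₀ ⊆ M i}), T₀, hT₀, subset_rfl, rfl, Or.inl rfl⟩
  let m : Fin n → P := fun i => ⟨(M ⟨i⟩ ∩ F, OrderDual.toDual {⟨i⟩}), M ⟨i⟩,
    (hM _).isPrimeTheory, hTM _, rfl, Or.inr ⟨⟨i⟩, rfl, rfl⟩⟩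
  refine ⟨UpperSet P, inferInstance, ⟨inferInstance, ?_⟩, fun hsat => ?_⟩
  · refine inClassBBot_upperSet r ?_ m ?_ ?_ ?_
    · rintro ⟨⟨p1, p2⟩, T, hT, h0, hp1, hp2⟩
      refine ⟨?_, fun i _ => hTM i⟩
      change T₀ ∩ F ⊆ p1
      obtain rfl : p1 = T ∩ F := hp1
      exact Set.inter_subset_inter_left F h0
    · intro i j h
      have h2 : ({⟨i⟩} : Set (ULift.{u} (Fin n))) = {⟨j⟩} := congrArg (fun p : P => p.1.2) h
      simpa using h2
    · rintro i ⟨⟨p1, p2⟩, T, hT, h0, hp1, hp2⟩ ⟨hle1, hle2⟩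
      change M ⟨i⟩ ∩ F ⊆ p1 at hle1
      change ∀ j, j ∈ OrderDual.ofDual p2 → j ∈ ({⟨i⟩} : Set (ULift.{u} (Fin n))) at hle2
      -- Labels shrink upwards and are never empty, so above `m i` the label is again `{i}`, which
      -- forces `T ⊆ M i`.
      have key : T ⊆ M ⟨i⟩ ∧ OrderDual.ofDual p2 = {⟨i⟩} := by
        simp only at hp2
        rcases hp2 with rfl | ⟨j, rfl, rfl⟩
        · obtain ⟨j, hj⟩ := hMsurj T hT.toIsTheory hT.falsum_notMem h0
          obtain rfl : j = ⟨i⟩ := hle2 j hj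
          exact ⟨hj, Set.Subset.antisymm hle2 (Set.singleton_subset_iff.2 hj)⟩
        · obtain rfl : j = ⟨i⟩ := hle2 j rfl
          exact ⟨subset_rfl, rfl⟩
      refine Subtype.ext (Prod.ext ?_ key.2)
      refine Set.Subset.antisymm ?_ hle1
      obtain rfl : p1 = T ∩ F := hp1
      exact Set.inter_subset_inter_left F key.1
    · rintro ⟨⟨p1, p2⟩, T, hT, h0, hp1, hp2⟩
      have key : ∃ i, T ⊆ M i ∧ ({i} : Set _) ⊆ OrderDual.ofDual p2 := by
        simp only at hp2
        rcases hp2 with rfl | ⟨j, rfl, rfl⟩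
        · obtain ⟨j, hj⟩ := hMsurj T hT.toIsTheory hT.falsum_notMem h0
          exact ⟨j, hj, Set.singleton_subset_iff.2 hj⟩
        · exact ⟨j, subset_rfl, subset_rfl⟩
      obtain ⟨i, hi, hi2⟩ := key
      refine ⟨i.down, ?_, hi2⟩
      change p1 ⊆ M i ∩ F
      obtain rfl : p1 = T ∩ F := hp1
      exact Set.inter_subset_inter_left F hi
  · have hsub : ∀ B, B ∈ F → subformulas B ⊆ F := fun B hB => by
      suffices h : ∀ C : PropFormula, B ∈ subformulas C → subformulas B ⊆ subformulas C from h A hB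
      intro C
      induction C with
      | var i => rintro rfl; rfl
      | neg C ih =>
        rintro (rfl | h)
        · rfl
        · exact (ih h).trans (Set.subset_insert _ _)
      | and C D ihC ihD | or C D ihC ihD | imp C D ihC ihD =>
        rintro (rfl | h | h)
        · rfl
        · exact ((ihC h).trans Set.subset_union_left).trans (Set.subset_insert _ _)
        · exact ((ihD h).trans Set.subset_union_right).trans (Set.subset_insert _ _)
    have hleft : ∀ {B C D}, D ∈ F → (subformulas D = insert D (subformulas B ∪ subformulas C)) →
        B ∈ F ∧ C ∈ F := fun {B C D} hD h =>
      have h' := hsub D hD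
      ⟨h' (h ▸ Or.inr (Or.inl (self_mem_subformulas B))),
        h' (h ▸ Or.inr (Or.inr (self_mem_subformulas C)))⟩
    -- Validity would put the root in the value of `A`, hence `A` in `T₀`.
    have htruth := mem_eval_iff (P := P) F (fun p => p.1.1) (fun p q (h : p.1 ≤ q.1) => h.1) ?_ ?_ ?_ ?_ A
      subset_rfl r
    · rw [hsat] at htruth
      exact hA (htruth.1 trivial).1
    · rintro p B C hBC
      obtain ⟨T, hT, hp, -⟩ := exists_framePoint_ge hM p
      obtain ⟨hB, hC⟩ := hleft (B := B) (C := C) hBC rfl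
      simp [hp, hBC, hB, hC, hT.and_mem_iff]
    · rintro p B C hBC
      obtain ⟨T, hT, hp, -⟩ := exists_framePoint_ge hM p
      obtain ⟨hB, hC⟩ := hleft (B := B) (C := C) hBC rfl
      simp [hp, hBC, hB, hC, hT.or_mem_iff]
    · rintro p B C hBC
      obtain ⟨T, hT, hp, hsucc⟩ := exists_framePoint_ge hM p
      obtain ⟨hB, hC⟩ := hleft (B := B) (C := C) hBC rfl
      constructor
      · intro h q hpq hq
        obtain ⟨T', hT', hq', -⟩ := exists_framePoint_ge hM q
        have h := hpq.1 h
        rw [hq'] at h hq ⊢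
        exact ⟨hT'.mp h.1 hq.1, hC⟩
      · intro h
        rw [hp]
        refine ⟨?_, hBC⟩
        by_contra hn
        obtain ⟨T', hT', hTT', hB', hC'⟩ := hT.exists_of_imp_notMem hn
        obtain ⟨q, hpq, hq⟩ := hsucc T' hT' hTT'
        have := h q hpq (hq ▸ ⟨hB', hB⟩)
        rw [hq] at this
        exact hC' this.1
    · rintro p B hnB
      obtain ⟨T, hT, hp, hsucc⟩ := exists_framePoint_ge hM p
      have hB : B ∈ F := hsub _ hnB (Or.inr (self_mem_subformulas B))
      constructor
      · intro h q hpq hq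
        obtain ⟨T', hT', hq', -⟩ := exists_framePoint_ge hM q
        have h := hpq.1 h
        rw [hq'] at h hq
        exact hT'.falsum_notMem (hT'.mem_of_neg_mem h.1 hq.1 _)
      · intro h
        rw [hp]
        refine ⟨?_, hnB⟩
        by_contra hn
        obtain ⟨T', hT', hTT', hB'⟩ := hT.exists_of_neg_notMem hn
        obtain ⟨q, hpq, hq⟩ := hsucc T' hT' hTT'
        exact h q hpq (hq ▸ ⟨hB', hB⟩)

end Completeness

end PropFormula

open PropFormula in
theorem mainTheorem7 (k n : ℕ) (hk : 1 ≤ k)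
    (hn : IsLeast {m : ℕ | 1 ≤ m ∧ k ≤ m.choose (m / 2)} n) :
    CompleteForBrouwerClass.{u} (PropFormula.ipcPlus (PropFormula.phi k))
      (fun L _ => Finite L ∧ InClassBBot n L) := by
  intro A
  constructor
  · intro hA L _ hL v
    refine eval_eq_bot_of_derivable ?_ hA v
    rintro _ rfl v
    exact eval_phi_eq_bot hk hn hL.2.1 v
  · intro h
    by_contra hA
    obtain ⟨T₀, -, hT₀⟩ := (isTheory_setOf_derivable {phi k}).exists_isMaxOmitting (A := A) hA
    obtain ⟨L, _, hL, hsat⟩ := exists_not_brouwerSatisfies.{u} hT₀.isPrimeTheory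
      (fun M hM hTM => not_injective_of_isMaxOmitting hn.1.2 hT₀.isPrimeTheory hM hTM hn.1.1)
      hT₀.1.2
    exact hsat (h L hL)
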